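/- **Setting.** Let $r,n\ge 1$. Let $G_{r,n}=(\mathbb Z/r)\wr\mathfrak S_n$ be the group of colored permutations $\pi=\sigma_1^{[z_1]}\cdots\sigma_n^{[z_n]}$ ($\sigma\in\mathfrak S_n$, $z_i\in\mathbb Z/r$), with product $(\sigma,z)(\rho,w)=(\sigma\rho,\,(w_i+z_{\rho(i)})_i)$. View $\pi$ also as the bijection $i^{[t]}\mapsto\sigma_i^{[z_i+t]}$ of the colored letters, and write $i$ for $i^{[0]}$. Let $\mathbf f=(f_1,\dots,f_n)$ be integers with $1\le f_1\le\cdots\le f_n\le n$, let $G_{r,n,\mathbf f}=\{\pi\in G_{r,n}:\sigma_i\le f_i \text{ for all } i\}$, and assume $G_{r,n,\mathbf f}\ne\emptyset$ (equivalently $f_i\ge i$ for all $i$). Put $H(\mathbf f)=(h_1,\dots,h_n)$, where $h_j$ is the smallest position at which the letter $j$ (in any color) occurs in some $\pi\in G_{r,n,\mathbf f}$. **Statistics.** - $\ell(\pi)$ is the least number of factors in an expression of $\pi$ as a product of the generators $s_0,\dots,s_{n-1}$ (repetitions allowed, no inverses). Under right multiplication $s_0$ adds $1$ to the color of the first letter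 and $s_i$ ($1\le i<n$) swaps the letters at positions $i$ and $i+1$. - For $1\le i<j\le n$ and $t\in\mathbb Z/r$, let $(i^{[t]}\,j)$ be the element that by right multiplication puts $\sigma_i^{[z_i+t]}$ at position $j$ and $\sigma_j^{[z_j-t]}$ at position $i$; let $(j^{[t]}\,j)$ be the one that adds $t$ to the color at position $j$. The sorting index $\mathsf{sor}(\pi)$ is obtained by sorting: for $j=n,n-1,\dots,1$ in turn, let $i^{[t]}$ ($0\le t<r$) be the colored letter that the current permutation maps to $j$, record the cost $j-i$ if $t=0$ and $j-i+2(i-1)+t$ if $t>0$, and multiply the current permutation on the right by $(i^{[t]}\,j)$. The process ends at the identity, and $\mathsf{sor}(\pi)$ is the sum of the costs. - $\mathsf{Rmil}^t(\pi)$ is the set of $\sigma_i$ with $z_i=t$ and $\sigma_i<\sigma_j$ for all $j>i$; $\mathsf{Lmil}^t(\pi)$ is the set of $\sigma_i$ with $z_i=t$ and $\sigma_i<\sigma_j$ for all $j<i$. - $\mathsf{Cyc}^t(\pi)$ is the set of the smallest letters of those cycles of $\sigma$ (fixed points included) for which the colors of the letters in the cycle have sum $t$. - $\mathsf{Lmic}^t(\pi)$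 is the set of $m$ such that $m^{[t]}$ is an entry of the word $\pi(1)\,\pi^2(1)\,\pi^3(1)\cdots$ and $m$ is smaller than the base value (the letter without its color) of every earlier entry. Superindices are taken modulo $r$. For a condition $A$ let $\xi_A(\omega)=\omega$ if $A$ holds and $\xi_A(\omega)=1$ otherwise. **Theorem.** As polynomials in $q$ and in $x_{t,i},y_{t,i}$ ($0\le t<r$, $1\le i\le n$), $$\sum_{\pi\in G_{r,n,\mathbf f}}q^{\ell(\pi)}\prod_{t=0}^{r-1}\Big(\prod_{i\in\mathsf{Rmil}^{-t}(\pi)}x_{t,i}\prod_{i\in\mathsf{Lmil}^{-t}(\pi)}y_{t,i}\Big)=\sum_{\pi\in G_{r,n,\mathbf f}}q^{\mathsf{sor}(\pi)}\prod_{t=0}^{r-1}\Big(\prod_{i\in\mathsf{Cyc}^{t}(\pi)}x_{t,i}\prod_{i\in\mathsf{Lmic}^{t}(\pi)}y_{t,i}\Big),$$ and both sides are equal to $$\prod_{j=1}^n\Big(\sum_{i=h_j}^{j}\xi_{i=j}(x_{0,j})\,\xi_{i=1}(y_{0,j})\,q^{j-i}+\sum_{t=1}^{r-1}\sum_{i=h_j}^{j}\xi_{i=j}(x_{r-t,j})\,\xi_{i=1}(y_{r-t,j})\,q^{j+i+t-2}\Big).$$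 That is, if $h_j<j$, the $j$-th factor is $$x_{0,j}+q+\cdots+q^{j-h_j-1}+\xi_{h_j=1}(y_{0,j})q^{j-h_j}+\sum_{t=1}^{r-1}\Big(x_{r-t,j}q^{2j+t-2}+q^{2j+t-3}+\cdots+q^{j+h_j+t-1}+\xi_{h_j=1}(y_{r-t,j})q^{j+h_j+t-2}\Big),$$ and if $h_j=j$, it is $\xi_{j=1}(y_{0,j})x_{0,j}+\sum_{t=1}^{r-1}\xi_{j=1}(y_{r-t,j})x_{r-t,j}q^{2j+t-2}$. -/

import Mathlib

/-- A colored permutation of `n` letters with `r` colors, as a pair `(σ, z)`. Positions and base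
values live in `Fin n` (so they are shifted by one, see `label`); the letter at position `i` is
`σ i` with color `z i`. -/
@[ext]
structure ColoredPerm (r n : ℕ) where
  perm : Equiv.Perm (Fin n)
  color : Fin n → ZMod r

namespace ColoredPerm

variable {r n : ℕ}

/-- The wreath product `(ℤ/r) ≀ S_n`, with the multiplication
`(σ, z) (ρ, w) = (σ ρ, w + ρ(z))`, where `ρ(z) i = z (ρ i)`. -/
instance : Group (ColoredPerm r n) where
  mul a b := ⟨a.perm * b.perm, fun i => b.color i + a.color (b.perm i)⟩
  one := ⟨1, fun _ => 0⟩
  inv a := ⟨a.perm⁻¹, fun i => -a.color (a.perm⁻¹ i)⟩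
  mul_assoc a b c := by
    ext i
    · rfl
    · change c.color i + (b.color (c.perm i) + a.color (b.perm (c.perm i)))
        = (c.color i + b.color (c.perm i)) + a.color (b.perm (c.perm i))
      rw [add_assoc]
  one_mul a := by
    ext i
    · rfl
    · change a.color i + 0 = a.color i
      rw [add_zero]
  mul_one a := by
    ext i
    · rfl
    · change 0 + a.color i = a.color i
      rw [zero_add]
  inv_mul_cancel a := by
    ext i
    · change ((a.perm⁻¹ * a.perm) i : ℕ) = ((1 : Equiv.Perm (Fin n)) i : ℕ)
      rw [inv_mul_cancel]
    · change a.color i + -a.color ((a.perm⁻¹ * a.perm) i) = 0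
      rw [inv_mul_cancel, Equiv.Perm.one_apply, add_neg_cancel]

/-- A colored permutation is the same thing as a pair. -/
def equivProd : ColoredPerm r n ≃ Equiv.Perm (Fin n) × (Fin n → ZMod r) where
  toFun a := (a.perm, a.color)
  invFun p := ⟨p.1, p.2⟩
  left_inv _ := rfl
  right_inv _ := rfl

instance [NeZero r] : Fintype (ColoredPerm r n) := Fintype.ofEquiv _ equivProd.symm

/-- The integer in `1, …, n` that is represented by an element of `Fin n`. -/
def label (i : Fin n) : ℕ := (i : ℕ) + 1

/-- The colored permutation as a map on all colored letters `i^[t]`; it commutes with adding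
bars. -/
def act (π : ColoredPerm r n) (a : Fin n × ZMod r) : Fin n × ZMod r :=
  (π.perm a.1, π.color a.1 + a.2)

/-- The generators `s_0, s_1, …, s_{n-1}`: adding one bar to the first letter, and swapping the
letters at two adjacent positions. -/
def generators (r n : ℕ) : Set (ColoredPerm r n) :=
  {g | (∃ i : Fin n, label i = 1 ∧ g = ⟨1, Pi.single i 1⟩) ∨
    ∃ i j : Fin n, label j = label i + 1 ∧ g = ⟨Equiv.swap i j, 0⟩}

/-- The length: the smallest number of generators whose product is `π`. -/
noncomputable def length (π : ColoredPerm r n) : ℕ :=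
  sInf {k | ∃ l : List (ColoredPerm r n), (∀ g ∈ l, g ∈ generators r n) ∧ l.prod = π ∧
    l.length = k}

/-- The transposition `(i^[t] j)`. Right multiplication by it puts the letter `σ_i^[z_i + t]` at
position `j` and, if `i ≠ j`, the letter `σ_j^[z_j - t]` at position `i`. -/
def transposition (i : Fin n) (t : ZMod r) (j : Fin n) : ColoredPerm r n :=
  if i = j then ⟨1, Pi.single i t⟩ else ⟨Equiv.swap i j, Pi.single j t - Pi.single i t⟩

/-- The distance from column `i`, row `t` to column `j`, row `0` (`i ≤ j`) in the graph with
columns `1, …, n` and rows `0, …, r - 1`, in which neighbours in a row and neighbours in the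
leftmost column are adjacent: `j - i` if `t = 0`, and `j - i + 2 (i - 1) + t` otherwise. -/
def sortDist (i : Fin n) (t : ZMod r) (j : Fin n) : ℕ :=
  (label j - label i) + if t = 0 then 0 else 2 * (label i - 1) + t.val

/-- The total distance in the sorting of the letters `k, k - 1, …, 1` in this order. The letter `j`
is found at the colored position `i^[t]` with `π (i^[t]) = j`, and is brought home by right
multiplication by `(i^[t] j)`; nothing happens if it is at home already. -/
def sortTotal : ℕ → ColoredPerm r n → ℕ
  | 0, _ => 0
  | k + 1, π =>
    if hk : k < n then
      let j : Fin n := ⟨k, hk⟩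
      let i : Fin n := π.perm.symm j
      let t : ZMod r := -π.color i
      sortDist i t j + sortTotal k (π * transposition i t j)
    else 0

/-- The sorting index. -/
def sor (π : ColoredPerm r n) : ℕ := sortTotal n π

/-- The (uncolored) letters of a set of colored letters that have the color `t`. -/
def refined (A : Finset (Fin n × ZMod r)) (t : ZMod r) : Finset ℕ :=
  (A.filter fun a => a.2 = t).image fun a => label a.1

/-- Right-to-left minimum letters. -/
def Rmil (π : ColoredPerm r n) : Finset (Fin n × ZMod r) :=
  (Finset.univ.filter fun i => ∀ j, i < j → π.perm i < π.perm j).image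
    fun i => (π.perm i, π.color i)

/-- Left-to-right minimum letters. -/
def Lmil (π : ColoredPerm r n) : Finset (Fin n × ZMod r) :=
  (Finset.univ.filter fun i => ∀ j, j < i → π.perm i < π.perm j).image
    fun i => (π.perm i, π.color i)

open Classical in
/-- The colored cycle set: for each cycle of `σ` (fixed points included) its smallest letter,
with the sum of the colors of all letters of the cycle. -/
noncomputable def Cyc (π : ColoredPerm r n) : Finset (Fin n × ZMod r) :=
  (Finset.univ.filter fun a => ∀ b, π.perm.SameCycle a b → a ≤ b).image
    fun a => (a, ∑ i ∈ Finset.univ.filter (fun i => π.perm.SameCycle a i), π.color i)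

open Classical in
/-- Left-to-right minimum letters, by base value, of the word `π(1) π²(1) π³(1) …`. -/
noncomputable def Lmic [NeZero r] (π : ColoredPerm r n) : Finset (Fin n × ZMod r) :=
  Finset.univ.filter fun a => ∃ e : Fin n, label e = 1 ∧ ∃ k : ℕ, 1 ≤ k ∧
    π.act^[k] (e, 0) = a ∧ ∀ m : ℕ, 1 ≤ m → m < k → a.1 < (π.act^[m] (e, 0)).1

/-- The colored permutations on the shape `f`, that is, with `σ(i) ≤ f_i` for all `i`. -/
def restricted (r : ℕ) [NeZero r] {n : ℕ} (f : Fin n → ℕ) : Finset (ColoredPerm r n) :=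
  Finset.univ.filter fun π => ∀ i, label (π.perm i) ≤ f i

/-- The entry `h_j` of `H(f)`: the smallest position at which the letter `j` appears in some
colored permutation on the shape `f`. -/
noncomputable def minPos (r : ℕ) [NeZero r] {n : ℕ} (f : Fin n → ℕ) (j : ℕ) : ℕ :=
  sInf {p | ∃ π ∈ restricted r f, ∃ i : Fin n, label i = p ∧ label (π.perm i) = j}

/-- The checking function `ξ_A(ω)`. -/
def xi {R : Type*} [One R] (A : Prop) [Decidable A] (w : R) : R := if A then w else 1

end ColoredPerm

namespace ColoredPerm

variable {r n : ℕ}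

/-! Both sums satisfy the same recursion in `n`. Every colored permutation of `n + 1` letters comes
from exactly one of `n` letters together with a position and a color, and there are two such
bijections. `insertWord` puts the largest letter into the word at the chosen position; `insertCycle`
appends it and undoes one sorting step, which splices it into a cycle or makes it a fixed point.
Each bijection multiplies the weight that belongs to it by the same monomial `insertWeight`, and
each turns the shape condition into the condition on the smaller permutation plus a lower bound on
the position. Hence both sums equal the same product over the letters (`sum_respects_eq_prod`).

On the word side this needs an explicit length. `length_eq_insertTotal` writes it as a sum over the
letters `j` of a cost depending on the color of `j` and on `rank`, the number of smaller letters to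
its left, which is the position at which `j` was inserted. Extreme ranks characterize the minima:
rank `j` for `Rmil`, rank `0` for `Lmil`.

On the cycle side the recursion for `sor` is the first sorting step. The new letter opens a cycle
exactly when it stays last, and enters `Lmic` exactly when it is the image of the first position. No
smaller letter changes its membership in `Cyc` or `Lmic`, or its color there. -/

@[simp] theorem mul_perm (a b : ColoredPerm r n) : (a * b).perm = a.perm * b.perm := rfl

@[simp] theorem mul_color (a b : ColoredPerm r n) (i : Fin n) :
    (a * b).color i = b.color i + a.color (b.perm i) := rfl

@[simp] theorem one_perm : (1 : ColoredPerm r n).perm = 1 := rfl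

@[simp] theorem one_color (i : Fin n) : (1 : ColoredPerm r n).color i = 0 := rfl

@[simp] theorem inv_perm (a : ColoredPerm r n) : a⁻¹.perm = a.perm⁻¹ := rfl

@[simp] theorem inv_color (a : ColoredPerm r n) (i : Fin n) :
    a⁻¹.color i = -a.color (a.perm⁻¹ i) := rfl

theorem ext_apply {a b : ColoredPerm r n} (h : ∀ i, a.perm i = b.perm i)
    (h' : ∀ i, a.color i = b.color i) : a = b := by
  cases a; cases b
  congr
  · exact Equiv.ext h
  · exact funext h'

theorem card_eq [NeZero r] : Fintype.card (ColoredPerm r n) = n.factorial * r ^ n := by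
  rw [Fintype.card_congr equivProd]
  simp [Fintype.card_perm, ZMod.card]

/-! ### Insertion recursions and product formulas -/

/-- The cost of bringing a new letter `j` into position `p` with color `c`
(letters and positions counted from zero). -/
def insertCost (j p : ℕ) (c : ZMod r) : ℕ := if c = 0 then j - p else j + p + c.val

/-- The weight of bringing a new letter `j` into position `p` with color `c`. -/
def insertWeight {R : Type*} [CommRing R] (q : R) (x y : ℕ → ℕ → R) (j p : ℕ) (c : ZMod r) : R :=
  (if p = j then x (-c).val (j + 1) else 1) * (if p = 0 then y (-c).val (j + 1) else 1) *
    q ^ insertCost j p c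

/-- The letter `j` does not occur before position `h j`. -/
def Respects (h : ℕ → ℕ) (π : ColoredPerm r n) : Prop := ∀ i, h (π.perm i) ≤ i

-- One abstract step serves both bijections: `ins` is the insertion, `w` the factor it contributes.
open Classical in
theorem sum_respects_succ [NeZero r] {R : Type*} [CommRing R] {h : ℕ → ℕ}
    {ins : ColoredPerm r n × Fin (n + 1) × ZMod r → ColoredPerm r (n + 1)}
    (hins : Function.Injective ins)
    (hP : ∀ π i t, Respects h (ins (π, i, t)) ↔ Respects h π ∧ h n ≤ i)
    {V : ColoredPerm r n → R} {W : ColoredPerm r (n + 1) → R} {w : ℕ → ZMod r → R}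
    (hW : ∀ π i t, W (ins (π, i, t)) = V π * w i t) :
    ∑ π with Respects h π, W π =
      (∑ π with Respects h π, V π) * ∑ i ∈ Finset.Icc (h n) n, ∑ t, w i t := by
  -- Both sides have `(n + 1)! * r ^ (n + 1)` elements, so no inverse has to be built.
  have hb : Function.Bijective ins := by
    rw [Fintype.bijective_iff_injective_and_card]
    refine ⟨hins, ?_⟩
    simp only [Fintype.card_prod, card_eq, ZMod.card, Fintype.card_fin, Nat.factorial_succ,
      pow_succ]
    ring
  have hI : ∑ i ∈ Finset.Icc (h n) n, ∑ t, w i t =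
      ∑ i : Fin (n + 1), if h n ≤ i then ∑ t, w i t else 0 := by
    rw [Fin.sum_univ_eq_sum_range (fun i => if h n ≤ i then ∑ t, w i t else 0),
      ← Finset.sum_filter]
    refine Finset.sum_congr ?_ fun _ _ => rfl
    ext i
    simp only [Finset.mem_Icc, Finset.mem_filter, Finset.mem_range]
    omega
  rw [hI, Finset.sum_filter, Finset.sum_filter, ← hb.sum_comp, Fintype.sum_prod_type,
    Finset.sum_mul]
  refine Finset.sum_congr rfl fun π _ => ?_
  rw [Fintype.sum_prod_type, Finset.mul_sum]
  refine Finset.sum_congr rfl fun i _ => ?_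
  simp only [hP, hW]
  by_cases h1 : Respects h π <;> by_cases h2 : h n ≤ i <;> simp [h1, h2, Finset.mul_sum]

open Classical in
theorem sum_respects_eq_prod [NeZero r] {R : Type*} [CommRing R] {h : ℕ → ℕ}
    {ins : ∀ n, ColoredPerm r n × Fin (n + 1) × ZMod r → ColoredPerm r (n + 1)}
    (hins : ∀ n, Function.Injective (ins n))
    (hP : ∀ n π i t, Respects h (ins n (π, i, t)) ↔ Respects h π ∧ h n ≤ i)
    {W : ∀ n, ColoredPerm r n → R} {w : ℕ → ℕ → ZMod r → R}
    (h0 : ∀ π, W 0 π = 1) (hW : ∀ n π i t, W (n + 1) (ins n (π, i, t)) = W n π * w n i t) (n : ℕ) :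
    ∑ π with Respects h π, W n π =
      ∏ j ∈ Finset.range n, ∑ i ∈ Finset.Icc (h j) j, ∑ t, w j i t := by
  induction n with
  | zero =>
    have hu : (Finset.univ.filter fun π : ColoredPerm r 0 => Respects h π) = {1} := by
      ext π
      simp only [Finset.mem_filter, Finset.mem_univ, true_and, Finset.mem_singleton]
      exact ⟨fun _ => ext_apply (fun i => i.elim0) fun i => i.elim0, fun _ i => i.elim0⟩
    simp [hu, h0]
  | succ n ih =>
    rw [sum_respects_succ (hins n) (hP n) (hW n), ih, Finset.prod_range_succ]

theorem prod_refined {M : Type*} [CommMonoid M] (A : Finset (Fin n × ZMod r)) (s : ZMod r)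
    (F : ℕ → M) : ∏ i ∈ refined A s, F i = ∏ a ∈ A with a.2 = s, F (label a.1) := by
  refine Finset.prod_image ?_
  rintro ⟨a, s⟩ ha ⟨b, t⟩ hb hab
  simp only [Finset.coe_filter, Set.mem_ofPred_eq] at ha hb
  simp only [label, add_left_inj, Fin.val_inj] at hab
  rw [hab, ha.2, hb.2]

/-- Each colored letter is met for exactly one `t`, the representative of its color under `e.symm`.
The equivalence `e` is negation for word minima and the identity for the cycle statistics. -/
theorem prod_range_refined [NeZero r] {M : Type*} [CommMonoid M] (A : Finset (Fin n × ZMod r))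
    (e : ZMod r ≃ ZMod r) (x : ℕ → ℕ → M) :
    ∏ t ∈ Finset.range r, ∏ i ∈ refined A (e t), x t i =
      ∏ a ∈ A, x (e.symm a.2).val (label a.1) := by
  simp only [prod_refined, Finset.prod_filter]
  rw [Finset.prod_comm]
  refine Finset.prod_congr rfl fun a _ => ?_
  rw [Finset.prod_eq_single (e.symm a.2).val]
  · simp
  · intro t ht hne
    rw [if_neg]
    intro h
    apply hne
    rw [h, Equiv.symm_apply_apply, ZMod.val_cast_of_lt (Finset.mem_range.1 ht)]
  · intro h
    exact absurd (Finset.mem_range.2 (ZMod.val_lt _)) h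

/-! ### The length as a sum of insertion costs -/

/-- The number of smaller letters to the left of the letter `j`. -/
def rank (π : ColoredPerm r n) (j : Fin n) : ℕ :=
  (Finset.univ.filter fun m => m < j ∧ π.perm.symm m < π.perm.symm j).card

/-- The color of the letter `j`. -/
def letterColor (π : ColoredPerm r n) (j : Fin n) : ZMod r := π.color (π.perm.symm j)

theorem card_lt (j : Fin n) : (Finset.univ.filter fun m : Fin n => m < j).card = j := by
  rw [← Fin.card_Iio j]
  congr 1
  ext m
  simp

theorem rank_le (π : ColoredPerm r n) (j : Fin n) : π.rank j ≤ j := by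
  rw [← card_lt j]
  exact Finset.card_le_card fun m => by simp +contextual

theorem rank_eq_iff (π : ColoredPerm r n) (j : Fin n) :
    π.rank j = j ↔ ∀ m < j, π.perm.symm m < π.perm.symm j := by
  conv_lhs => rw [← card_lt j]
  rw [rank, ← Finset.filter_filter, Finset.card_filter_eq_iff]
  simp

theorem rank_eq_zero_iff (π : ColoredPerm r n) (j : Fin n) :
    π.rank j = 0 ↔ ∀ m < j, π.perm.symm j < π.perm.symm m := by
  rw [rank, Finset.card_eq_zero, Finset.filter_eq_empty_iff]
  simp only [Finset.mem_univ, true_imp_iff, not_and, not_lt]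
  refine forall₂_congr fun m hm => ⟨fun h => lt_of_le_of_ne h ?_, le_of_lt⟩
  simpa using hm.ne'

/-- The sum over all letters of the cost of its insertion into the word of the smaller ones. -/
def insertTotal (π : ColoredPerm r n) : ℕ :=
  ∑ j : Fin n, insertCost j (π.rank j) (π.letterColor j)

theorem insertTotal_one : insertTotal (1 : ColoredPerm r n) = 0 := by
  refine Finset.sum_eq_zero fun j _ => ?_
  have h : (1 : ColoredPerm r n).rank j = j := by
    rw [rank_eq_iff]
    exact fun m hm => hm
  simp [h, letterColor, insertCost]

/-- The element that swaps the letters at the positions `i` and `k`. -/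
def swapGen (r : ℕ) (i k : Fin n) : ColoredPerm r n := ⟨Equiv.swap i k, 0⟩

theorem swapGen_mul_self (i k : Fin n) : swapGen r i k * swapGen r i k = 1 := by
  refine ext_apply (fun a => ?_) fun a => ?_ <;> simp [swapGen]

theorem symm_mul_swapGen (π : ColoredPerm r n) (i k m : Fin n) :
    (π * swapGen r i k).perm.symm m = Equiv.swap i k (π.perm.symm m) := by
  rw [Equiv.symm_apply_eq]
  simp [swapGen]

theorem letterColor_mul_swapGen (π : ColoredPerm r n) (i k j : Fin n) :
    (π * swapGen r i k).letterColor j = π.letterColor j := by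
  rw [letterColor, symm_mul_swapGen]
  simp [swapGen, letterColor]

theorem swap_lt_swap_iff {i k : Fin n} (hik : (k : ℕ) = i + 1) {a b : Fin n}
    (h₁ : ¬(a = i ∧ b = k)) (h₂ : ¬(a = k ∧ b = i)) :
    Equiv.swap i k a < Equiv.swap i k b ↔ a < b := by
  simp only [Equiv.swap_apply_def]
  split_ifs <;> simp only [Fin.ext_iff, Fin.lt_def] at * <;> omega

theorem rank_mul_swapGen_of_ne {π : ColoredPerm r n} {i k : Fin n} (hik : (k : ℕ) = i + 1)
    (hlt : π.perm i < π.perm k) {j : Fin n} (hj : j ≠ π.perm k) :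
    (π * swapGen r i k).rank j = π.rank j := by
  rw [rank, rank]
  congr 1
  ext m
  simp only [Finset.mem_filter, Finset.mem_univ, true_and, symm_mul_swapGen]
  refine and_congr_right fun hm => swap_lt_swap_iff hik ?_ ?_
  · rintro ⟨-, h⟩
    exact hj (by rw [← h, Equiv.apply_symm_apply])
  · rintro ⟨h₁, h₂⟩
    rw [Equiv.symm_apply_eq] at h₁ h₂
    subst h₁ h₂
    exact absurd hm hlt.not_gt

/-- The larger of the two swapped letters loses the smaller one from its left; every other rank is
unaffected. -/
theorem rank_mul_swapGen_self {π : ColoredPerm r n} {i k : Fin n} (hik : (k : ℕ) = i + 1)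
    (hlt : π.perm i < π.perm k) :
    (π * swapGen r i k).rank (π.perm k) + 1 = π.rank (π.perm k) := by
  rw [rank, rank, ← Finset.card_insert_of_notMem (a := π.perm i)]
  · congr 1
    ext m
    obtain ⟨a, rfl⟩ := π.perm.surjective m
    simp only [Finset.mem_insert, Finset.mem_filter, Finset.mem_univ, true_and, symm_mul_swapGen,
      Equiv.symm_apply_apply, Equiv.swap_apply_right, EmbeddingLike.apply_eq_iff_eq]
    constructor
    · rintro (rfl | ⟨h₁, h₂⟩)
      · exact ⟨hlt, by rw [Fin.lt_def]; omega⟩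
      · refine ⟨h₁, ?_⟩
        rw [Equiv.swap_apply_def] at h₂
        split_ifs at h₂ <;> simp only [Fin.ext_iff, Fin.lt_def] at * <;> omega
    · rintro ⟨h₁, h₂⟩
      by_cases ha : a = i
      · exact Or.inl ha
      · refine Or.inr ⟨h₁, ?_⟩
        rw [Equiv.swap_apply_of_ne_of_ne ha h₂.ne]
        simp only [Fin.ext_iff, Fin.lt_def] at *
        omega
  · simp only [Finset.mem_filter, Finset.mem_univ, true_and, symm_mul_swapGen,
      Equiv.symm_apply_apply, Equiv.swap_apply_right, Equiv.swap_apply_left, Fin.lt_def]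
    omega

theorem sum_eq_of_eq_off {ι : Type*} [Fintype ι] [DecidableEq ι] {F G : ι → ℕ} (a : ι)
    (h : ∀ j, j ≠ a → F j = G j) : ∑ j, F j + G a = ∑ j, G j + F a := by
  rw [← Finset.add_sum_erase _ F (Finset.mem_univ a), ← Finset.add_sum_erase _ G
    (Finset.mem_univ a), Finset.sum_congr rfl fun j hj => h j (Finset.ne_of_mem_erase hj)]
  ring

/-- Only the larger letter changes rank, dropping by one. The cost decreases with the rank for color
zero and increases with it otherwise, whence the two directions. -/
theorem insertTotal_mul_swapGen {π : ColoredPerm r n} {i k : Fin n} (hik : (k : ℕ) = i + 1)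
    (hlt : π.perm i < π.perm k) :
    (π.color k = 0 → (π * swapGen r i k).insertTotal = π.insertTotal + 1) ∧
      (π.color k ≠ 0 → (π * swapGen r i k).insertTotal + 1 = π.insertTotal) := by
  have h := sum_eq_of_eq_off
    (F := fun j : Fin n => insertCost j ((π * swapGen r i k).rank j)
      ((π * swapGen r i k).letterColor j))
    (G := fun j : Fin n => insertCost j (π.rank j) (π.letterColor j)) (π.perm k) (by
      intro j hj
      simp only [letterColor_mul_swapGen, rank_mul_swapGen_of_ne hik hlt hj])
  have h₁ := rank_mul_swapGen_self hik hlt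
  -- This bound keeps the truncated subtraction in `insertCost` exact.
  have h₂ := π.rank_le (π.perm k)
  have h₃ : π.letterColor (π.perm k) = π.color k := by simp [letterColor]
  change insertTotal _ + _ = insertTotal _ + _ at h
  simp only [letterColor_mul_swapGen, h₃, insertCost] at h
  constructor
  · intro hc
    simp only [hc, if_true] at h
    omega
  · intro hc
    simp only [hc, if_false] at h
    omega

/-- The element that adds `c` to the color of the letter at position `e`. -/
def colorGen (e : Fin n) (c : ZMod r) : ColoredPerm r n := ⟨1, Pi.single e c⟩

theorem insertTotal_mul_colorGen [NeZero r] (π : ColoredPerm r n) {e : Fin n} (he : (e : ℕ) = 0)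
    (c : ZMod r) : (π * colorGen e c).insertTotal + (π.color e).val =
      π.insertTotal + (c + π.color e).val := by
  have hs : ∀ m, (π * colorGen e c).perm.symm m = π.perm.symm m := by
    intro m
    rw [Equiv.symm_apply_eq]
    simp [colorGen]
  have hr : ∀ j, (π * colorGen e c).rank j = π.rank j := by
    intro j
    simp only [rank, hs]
  have hc : ∀ j, (π * colorGen e c).letterColor j =
      (Pi.single e c : Fin n → ZMod r) (π.perm.symm j) + π.letterColor j := by
    intro j
    simp only [letterColor, hs, mul_color]
    simp [colorGen]
  have h0 : π.rank (π.perm e) = 0 := by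
    rw [rank_eq_zero_iff]
    intro m hm
    rw [Equiv.symm_apply_apply, Fin.lt_def, he]
    refine Nat.pos_of_ne_zero fun h => hm.ne ?_
    rw [← Equiv.symm_apply_eq, Fin.ext_iff, h, he]
  have h := sum_eq_of_eq_off
    (F := fun j : Fin n => insertCost j ((π * colorGen e c).rank j)
      ((π * colorGen e c).letterColor j))
    (G := fun j : Fin n => insertCost j (π.rank j) (π.letterColor j)) (π.perm e) (by
      intro j hj
      have : π.perm.symm j ≠ e := by rwa [Ne, Equiv.symm_apply_eq]
      simp [hr, hc, this])
  -- At rank zero the two branches of `insertCost` agree, so a color wrapping around to zero needs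
  -- no separate case.
  have hcost : ∀ (j : ℕ) (d : ZMod r), insertCost j 0 d = j + d.val := by
    intro j d
    by_cases hd : d = 0 <;> simp [insertCost, hd]
  change insertTotal _ + _ = insertTotal _ + _ at h
  simp only [hr, hc, h0, hcost] at h
  simp only [letterColor, Equiv.symm_apply_apply, Pi.single_eq_same] at h
  omega

theorem insertTotal_mul_generator_le [NeZero r] (π : ColoredPerm r n) {g : ColoredPerm r n}
    (hg : g ∈ generators r n) : (π * g).insertTotal ≤ π.insertTotal + 1 := by
  rcases hg with ⟨e, he, rfl⟩ | ⟨i, k, hik, rfl⟩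
  · have h := insertTotal_mul_colorGen π (e := e) (by simpa [label] using he) 1
    have h₁ := ZMod.val_add_le 1 (π.color e)
    have h₂ : (1 : ZMod r).val ≤ 1 := by
      rw [ZMod.val_one_eq_one_mod]
      exact Nat.mod_le _ _
    change (π * colorGen e 1).insertTotal ≤ _
    omega
  · change (π * swapGen r i k).insertTotal ≤ _
    have hik : (k : ℕ) = i + 1 := by simpa [label] using hik
    have hne : i ≠ k := fun h => by subst h; omega
    rcases lt_or_gt_of_ne (π.perm.injective.ne hne) with hlt | hlt
    · have h := insertTotal_mul_swapGen hik hlt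
      by_cases hc : π.color k = 0
      · exact (h.1 hc).le
      · have := h.2 hc
        omega
    · have h := insertTotal_mul_swapGen (π := π * swapGen r i k) hik (by simpa [swapGen] using hlt)
      rw [mul_assoc, swapGen_mul_self, mul_one] at h
      by_cases hc : (π * swapGen r i k).color k = 0
      · have := h.1 hc
        omega
      · have := h.2 hc
        omega

theorem insertTotal_list_prod_le [NeZero r] (l : List (ColoredPerm r n))
    (hl : ∀ g ∈ l, g ∈ generators r n) : l.prod.insertTotal ≤ l.length := by
  induction l using List.reverseRecOn with
  | nil => simp [insertTotal_one]
  | append_singleton l g ih =>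
    rw [List.prod_append, List.prod_singleton, List.length_append, List.length_singleton]
    have h₁ := ih fun g hg => hl g (by simp [hg])
    have h₂ := insertTotal_mul_generator_le l.prod (hl g (by simp))
    omega

theorem eq_one_of_strictMono {σ : Equiv.Perm (Fin n)} (h : StrictMono σ) : σ = 1 := by
  have := Subsingleton.elim (h.orderIsoOfSurjective σ σ.surjective) (OrderIso.refl _)
  ext i
  exact congrArg (fun e : Fin n ≃o Fin n => (e i : ℕ)) this

/-- A colored permutation other than `1` is shortened by some generator. -/
theorem exists_descent [NeZero r] (π : ColoredPerm r n) (hπ : π ≠ 1) :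
    ∃ g ∈ generators r n, ∃ ρ : ColoredPerm r n, ρ * g = π ∧ ρ.insertTotal + 1 = π.insertTotal := by
  by_contra hno
  apply hπ
  obtain _ | n := n
  · exact ext_apply (fun i => i.elim0) fun i => i.elim0
  have h0 : π.color 0 = 0 := by
    by_contra hc
    refine hno ⟨colorGen 0 1, Or.inl ⟨0, rfl, rfl⟩, π * colorGen 0 (-1), ?_, ?_⟩
    · refine ext_apply (fun a => ?_) fun a => ?_
      · simp [colorGen]
      · by_cases ha : a = 0 <;> simp [colorGen, ha]
    · have h := insertTotal_mul_colorGen π (e := 0) rfl (-1)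
      have hv : (-1 + π.color 0).val + 1 = (π.color 0).val := by
        have h₁ : 0 < (π.color 0).val := by
          rw [Nat.pos_iff_ne_zero, Ne, ZMod.val_eq_zero]
          exact hc
        have h₂ : -1 + π.color 0 = (((π.color 0).val - 1 : ℕ) : ZMod r) := by
          rw [Nat.cast_sub h₁, ZMod.natCast_zmod_val]
          push_cast
          ring
        rw [h₂, ZMod.val_cast_of_lt (by have := ZMod.val_lt (π.color 0); omega)]
        omega
      omega
  -- Without a descent, an uncolored letter can only be followed by a larger uncolored one. Starting
  -- from `h0`, this removes all colors and makes the word increasing.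
  have hstep : ∀ i : Fin n, π.perm i.castSucc < π.perm i.succ ∧ π.color i.succ = 0 ∨
      π.color i.castSucc ≠ 0 := by
    intro i
    have hik : (i.succ : ℕ) = i.castSucc + 1 := rfl
    by_contra hcon
    rw [not_or, not_not] at hcon
    refine hno ⟨swapGen r i.castSucc i.succ, Or.inr ⟨_, _, rfl, rfl⟩,
      π * swapGen r i.castSucc i.succ, by rw [mul_assoc, swapGen_mul_self, mul_one], ?_⟩
    rcases lt_or_gt_of_ne (π.perm.injective.ne (Fin.castSucc_lt_succ (i := i)).ne) with hlt | hlt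
    · exact (insertTotal_mul_swapGen hik hlt).2 fun h => hcon.1 ⟨hlt, h⟩
    · have h := (insertTotal_mul_swapGen (π := π * swapGen r i.castSucc i.succ) hik
        (by simpa [swapGen] using hlt)).1 (by simpa [swapGen] using hcon.2)
      rw [mul_assoc, swapGen_mul_self, mul_one] at h
      exact h.symm
  have hcol : ∀ i, π.color i = 0 := by
    intro i
    induction i using Fin.induction with
    | zero => exact h0
    | succ i ih => exact ((hstep i).resolve_right (not_not.2 ih)).2
  have hσ : π.perm = 1 := eq_one_of_strictMono
    (Fin.strictMono_iff_lt_succ.2 fun i => ((hstep i).resolve_right (not_not.2 (hcol _))).1)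
  exact ext_apply (fun i => by rw [hσ]; rfl) hcol

theorem exists_list_prod_eq [NeZero r] (π : ColoredPerm r n) :
    ∃ l : List (ColoredPerm r n), (∀ g ∈ l, g ∈ generators r n) ∧ l.prod = π ∧
      l.length = π.insertTotal := by
  induction hk : π.insertTotal generalizing π with
  | zero =>
    by_cases h1 : π = 1
    · exact ⟨[], by simp, by simp [h1], rfl⟩
    · obtain ⟨g, -, ρ, -, h⟩ := exists_descent π h1
      omega
  | succ k ih =>
    by_cases h1 : π = 1
    · rw [h1, insertTotal_one] at hk
      omega
    · obtain ⟨g, hg, ρ, rfl, h⟩ := exists_descent π h1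
      obtain ⟨l, hl, rfl, hlen⟩ := ih ρ (by omega)
      refine ⟨l ++ [g], ?_, by simp, by simp [hlen]⟩
      intro g' hg'
      rcases List.mem_append.1 hg' with h' | h'
      · exact hl g' h'
      · rw [List.mem_singleton.1 h']
        exact hg

theorem length_eq_insertTotal [NeZero r] (π : ColoredPerm r n) : π.length = π.insertTotal := by
  refine le_antisymm (Nat.sInf_le (exists_list_prod_eq π)) (le_csInf ⟨_, exists_list_prod_eq π⟩ ?_)
  rintro k ⟨l, hl, rfl, rfl⟩
  exact insertTotal_list_prod_le l hl

/-! ### Word minima in terms of ranks -/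

theorem prod_image_letters {M : Type*} [CommMonoid M] (π : ColoredPerm r n) (P : Fin n → Prop)
    [DecidablePred P] (F : Fin n × ZMod r → M) :
    ∏ a ∈ (Finset.univ.filter P).image fun i => (π.perm i, π.color i), F a =
      ∏ j, if P (π.perm.symm j) then F (j, π.letterColor j) else 1 := by
  rw [Finset.prod_image fun a _ b _ h => π.perm.injective (congrArg Prod.fst h),
    Finset.prod_filter, ← π.perm.symm.prod_comp]
  simp [letterColor]

theorem forall_gt_iff_rank_eq (π : ColoredPerm r n) (j : Fin n) :
    (∀ k, π.perm.symm j < k → π.perm (π.perm.symm j) < π.perm k) ↔ π.rank j = j := by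
  rw [rank_eq_iff, Equiv.apply_symm_apply]
  constructor
  · intro h m hm
    by_contra hcon
    rcases (not_lt.1 hcon).lt_or_eq with hlt | heq
    · have := h _ hlt
      rw [Equiv.apply_symm_apply] at this
      exact this.not_gt hm
    · exact hm.ne' (π.perm.symm.injective heq)
  · intro h k hk
    by_contra hcon
    rcases (not_lt.1 hcon).lt_or_eq with hlt | heq
    · have := h _ hlt
      rw [Equiv.symm_apply_apply] at this
      exact this.not_gt hk
    · rw [← heq, Equiv.symm_apply_apply] at hk
      exact hk.false

theorem forall_lt_iff_rank_eq_zero (π : ColoredPerm r n) (j : Fin n) :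
    (∀ k, k < π.perm.symm j → π.perm (π.perm.symm j) < π.perm k) ↔ π.rank j = 0 := by
  rw [rank_eq_zero_iff, Equiv.apply_symm_apply]
  constructor
  · intro h m hm
    by_contra hcon
    rcases (not_lt.1 hcon).lt_or_eq with hlt | heq
    · have := h _ hlt
      rw [Equiv.apply_symm_apply] at this
      exact this.not_gt hm
    · exact hm.ne (π.perm.symm.injective heq)
  · intro h k hk
    by_contra hcon
    rcases (not_lt.1 hcon).lt_or_eq with hlt | heq
    · have := h _ hlt
      rw [Equiv.symm_apply_apply] at this
      exact this.not_gt hk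
    · rw [← heq, Equiv.symm_apply_apply] at hk
      exact hk.false

theorem length_weight_eq [NeZero r] {R : Type*} [CommRing R] (q : R) (x y : ℕ → ℕ → R)
    (π : ColoredPerm r n) :
    q ^ π.length * ∏ t ∈ Finset.range r, ((∏ i ∈ refined π.Rmil (-(t : ZMod r)), x t i) *
      ∏ i ∈ refined π.Lmil (-(t : ZMod r)), y t i) =
    ∏ j : Fin n, insertWeight q x y j (π.rank j) (π.letterColor j) := by
  have hx := prod_range_refined π.Rmil (Equiv.neg (ZMod r)) x
  have hy := prod_range_refined π.Lmil (Equiv.neg (ZMod r)) y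
  rw [Rmil, prod_image_letters] at hx
  rw [Lmil, prod_image_letters] at hy
  simp only [forall_gt_iff_rank_eq] at hx
  simp only [forall_lt_iff_rank_eq_zero] at hy
  simp only [Equiv.neg_apply, Equiv.neg_symm] at hx hy
  rw [Finset.prod_mul_distrib, Rmil, Lmil, hx, hy, length_eq_insertTotal, insertTotal,
    ← Finset.prod_pow_eq_pow_sum, ← Finset.prod_mul_distrib, ← Finset.prod_mul_distrib]
  refine Finset.prod_congr rfl fun j _ => ?_
  rw [insertWeight, mul_comm]
  rfl

/-! ### Insertion into the word -/

/-- Insertion of the largest letter with color `c` into the word of `π`, at position `p`. -/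
def insertWord (a : ColoredPerm r n × Fin (n + 1) × ZMod r) : ColoredPerm r (n + 1) :=
  ⟨(finSuccEquiv' a.2.1).trans
    ((Equiv.optionCongr a.1.perm).trans (finSuccEquiv' (Fin.last n)).symm),
    Fin.insertNth (α := fun _ => ZMod r) a.2.1 a.2.2 a.1.color⟩

section
variable (π : ColoredPerm r n) (p : Fin (n + 1)) (c : ZMod r)

@[simp] theorem insertWord_perm_self : (insertWord (π, p, c)).perm p = Fin.last n := by
  simp [insertWord]

@[simp] theorem insertWord_perm_succAbove (a : Fin n) :
    (insertWord (π, p, c)).perm (p.succAbove a) = (π.perm a).castSucc := by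
  simp [insertWord]

@[simp] theorem insertWord_color_self : (insertWord (π, p, c)).color p = c := by
  simp [insertWord]

@[simp] theorem insertWord_color_succAbove (a : Fin n) :
    (insertWord (π, p, c)).color (p.succAbove a) = π.color a := by
  simp [insertWord]

@[simp] theorem insertWord_symm_last : (insertWord (π, p, c)).perm.symm (Fin.last n) = p := by
  rw [Equiv.symm_apply_eq, insertWord_perm_self]

@[simp] theorem insertWord_symm_castSucc (j : Fin n) :
    (insertWord (π, p, c)).perm.symm j.castSucc = p.succAbove (π.perm.symm j) := by
  rw [Equiv.symm_apply_eq, insertWord_perm_succAbove, Equiv.apply_symm_apply]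

theorem insertWord_injective :
    Function.Injective (insertWord : ColoredPerm r n × Fin (n + 1) × ZMod r → _) := by
  rintro ⟨π, p, c⟩ ⟨ρ, p', c'⟩ h
  have hp : p = p' := by
    rw [← insertWord_symm_last π p c, h, insertWord_symm_last]
  subst hp
  have hc : c = c' := by
    rw [← insertWord_color_self π p c, h, insertWord_color_self]
  subst hc
  have hπ : π = ρ := by
    refine ext_apply (fun a => ?_) fun a => ?_
    · apply Fin.castSucc_injective
      rw [← insertWord_perm_succAbove π p c, h, insertWord_perm_succAbove]
    · rw [← insertWord_color_succAbove π p c, h, insertWord_color_succAbove]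
  rw [hπ]

theorem le_succAbove (a : Fin n) : (a : ℕ) ≤ p.succAbove a := by
  rw [Fin.succAbove]
  split_ifs <;> simp

theorem respects_insertWord {h : ℕ → ℕ} (hh : Monotone h) :
    Respects h (insertWord (π, p, c)) ↔ Respects h π ∧ h n ≤ p := by
  constructor
  · intro H
    have hp : h n ≤ p := by simpa using H p
    refine ⟨fun a => ?_, hp⟩
    have ha := H (p.succAbove a)
    rw [insertWord_perm_succAbove, Fin.val_castSucc] at ha
    by_cases hap : a.castSucc < p
    · rwa [Fin.succAbove_of_castSucc_lt _ _ hap] at ha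
    -- Letters behind `p` move back by one on removal, but still sit at or after `p`, and `p` is at
    -- least `h n`, which bounds `h` of every smaller letter.
    · have h₁ := hh (π.perm a).is_lt.le
      rw [Fin.lt_def, Fin.val_castSucc] at hap
      omega
  · rintro ⟨H, hp⟩ i
    rcases Fin.eq_self_or_eq_succAbove p i with rfl | ⟨a, rfl⟩
    · simpa using hp
    · rw [insertWord_perm_succAbove, Fin.val_castSucc]
      exact (H a).trans (le_succAbove p a)

theorem card_filter_castSucc (P : Fin (n + 1) → Prop) [DecidablePred P] (hP : ¬P (Fin.last n)) :
    (Finset.univ.filter P).card = (Finset.univ.filter fun a : Fin n => P a.castSucc).card := by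
  rw [Finset.card_filter, Fin.sum_univ_castSucc, Finset.card_filter, if_neg hP, add_zero]

theorem rank_insertWord_castSucc (j : Fin n) :
    (insertWord (π, p, c)).rank j.castSucc = π.rank j := by
  rw [rank, card_filter_castSucc _ (fun h => (Fin.castSucc_lt_last j).not_gt h.1), rank]
  simp [Fin.succAbove_lt_succAbove_iff]

theorem rank_insertWord_last : (insertWord (π, p, c)).rank (Fin.last n) = p := by
  rw [rank, card_filter_castSucc _ (fun h => h.1.false)]
  simp only [insertWord_symm_castSucc, insertWord_symm_last, Fin.castSucc_lt_last, true_and,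
    Fin.succAbove_lt_iff_castSucc_lt]
  rw [Finset.card_filter, π.perm.symm.sum_comp fun a => if a.castSucc < p then 1 else 0,
    ← Finset.card_filter, ← card_filter_castSucc (fun a => a < p) (Fin.le_last p).not_gt,
    card_lt]

theorem prod_rank_insertWord {R : Type*} [CommRing R] (q : R) (x y : ℕ → ℕ → R) :
    ∏ j : Fin (n + 1), insertWeight q x y j ((insertWord (π, p, c)).rank j)
        ((insertWord (π, p, c)).letterColor j) =
      (∏ j : Fin n, insertWeight q x y j (π.rank j) (π.letterColor j)) *
        insertWeight q x y n p c := by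
  rw [Fin.prod_univ_castSucc]
  simp [rank_insertWord_castSucc, rank_insertWord_last, letterColor]

end

open Classical in
theorem sum_length_eq [NeZero r] {R : Type*} [CommRing R] (q : R) (x y : ℕ → ℕ → R)
    {h : ℕ → ℕ} (hh : Monotone h) (n : ℕ) :
    ∑ π : ColoredPerm r n with Respects h π,
      q ^ π.length * ∏ t ∈ Finset.range r, ((∏ i ∈ refined π.Rmil (-(t : ZMod r)), x t i) *
        ∏ i ∈ refined π.Lmil (-(t : ZMod r)), y t i) =
      ∏ j ∈ Finset.range n, ∑ i ∈ Finset.Icc (h j) j, ∑ t : ZMod r, insertWeight q x y j i t := by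
  simp only [length_weight_eq]
  exact sum_respects_eq_prod
    (W := fun n π => ∏ j : Fin n, insertWeight q x y j (π.rank j) (π.letterColor j))
    (w := insertWeight q x y) (fun _ => insertWord_injective)
    (fun n π i t => respects_insertWord π i t hh) (fun π => by simp)
    (fun n π i t => prod_rank_insertWord π i t q x y) n

/-! ### Insertion into a cycle -/

/-- The colored permutation `π` with the letter `n + 1` appended, and the sorting step
`(i^[t] n+1)` undone. -/
def insertCycle (a : ColoredPerm r n × Fin (n + 1) × ZMod r) : ColoredPerm r (n + 1) :=
  insertWord (a.1, Fin.last n, 0) * (transposition a.2.1 a.2.2 (Fin.last n))⁻¹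

theorem extend_perm_castSucc (π : ColoredPerm r n) (c : ZMod r) (a : Fin n) :
    (insertWord (π, Fin.last n, c)).perm a.castSucc = (π.perm a).castSucc := by
  rw [← Fin.succAbove_last_apply, insertWord_perm_succAbove]

theorem extend_color_castSucc (π : ColoredPerm r n) (c : ZMod r) (a : Fin n) :
    (insertWord (π, Fin.last n, c)).color a.castSucc = π.color a := by
  rw [← Fin.succAbove_last_apply, insertWord_color_succAbove]

theorem transposition_perm (i : Fin n) (t : ZMod r) (j : Fin n) :
    (transposition i t j).perm = Equiv.swap i j := by
  rw [transposition]
  split_ifs with h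
  · rw [h, Equiv.swap_self]
    rfl
  · rfl

section
variable (π : ColoredPerm r n) (i : Fin (n + 1)) (t : ZMod r)

theorem insertCycle_perm (a : Fin (n + 1)) : (insertCycle (π, i, t)).perm a =
    (insertWord (π, Fin.last n, 0)).perm (Equiv.swap i (Fin.last n) a) := by
  simp [insertCycle, transposition_perm]

theorem insertCycle_color (a : Fin (n + 1)) : (insertCycle (π, i, t)).color a =
    -(transposition i t (Fin.last n)).color (Equiv.swap i (Fin.last n) a) +
      (insertWord (π, Fin.last n, 0)).color (Equiv.swap i (Fin.last n) a) := by
  simp [insertCycle, transposition_perm]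

@[simp] theorem insertCycle_perm_self : (insertCycle (π, i, t)).perm i = Fin.last n := by
  simp [insertCycle_perm]

-- This sign is why `insertWeight` uses `-c`. On the word side the same sign comes from the
-- superscript of `Rmil` and `Lmil`.
@[simp] theorem insertCycle_color_self : (insertCycle (π, i, t)).color i = -t := by
  rw [insertCycle_color, Equiv.swap_apply_left, insertWord_color_self, add_zero, transposition]
  split_ifs with h
  · simp [h]
  · simp [Ne.symm h]

theorem insertCycle_perm_of_ne {a : Fin n} (h : a.castSucc ≠ i) :
    (insertCycle (π, i, t)).perm a.castSucc = (π.perm a).castSucc := by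
  rw [insertCycle_perm, Equiv.swap_apply_of_ne_of_ne h (Fin.castSucc_lt_last a).ne,
    extend_perm_castSucc]

theorem insertCycle_color_of_ne {a : Fin n} (h : a.castSucc ≠ i) :
    (insertCycle (π, i, t)).color a.castSucc = π.color a := by
  rw [insertCycle_color, Equiv.swap_apply_of_ne_of_ne h (Fin.castSucc_lt_last a).ne,
    extend_color_castSucc, transposition]
  split_ifs with h'
  · simp [h]
  · simp [h, (Fin.castSucc_lt_last a).ne]

theorem insertCycle_perm_last (b : Fin n) :
    (insertCycle (π, b.castSucc, t)).perm (Fin.last n) = (π.perm b).castSucc := by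
  rw [insertCycle_perm, Equiv.swap_apply_right, extend_perm_castSucc]

theorem insertCycle_color_last (b : Fin n) :
    (insertCycle (π, b.castSucc, t)).color (Fin.last n) = t + π.color b := by
  rw [insertCycle_color, Equiv.swap_apply_right, extend_color_castSucc, transposition,
    if_neg (Fin.castSucc_lt_last b).ne]
  simp [(Fin.castSucc_lt_last b).ne]

theorem insertCycle_symm_last : (insertCycle (π, i, t)).perm.symm (Fin.last n) = i := by
  rw [Equiv.symm_apply_eq, insertCycle_perm_self]

theorem insertCycle_injective :
    Function.Injective (insertCycle : ColoredPerm r n × Fin (n + 1) × ZMod r → _) := by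
  rintro ⟨π, i, t⟩ ⟨ρ, i', t'⟩ h
  have hi : i = i' := by
    rw [← insertCycle_symm_last π i t, h, insertCycle_symm_last]
  subst hi
  have ht : t = t' := by
    rw [← neg_inj, ← insertCycle_color_self π i t, h, insertCycle_color_self]
  subst ht
  have := insertWord_injective (mul_right_cancel h)
  exact congrArg (fun ρ => (ρ, i, t)) (congrArg Prod.fst this)

/-- The letter displaced from `i` moves right to the last position, which cannot hurt. Conversely it
may return to `i`, since monotonicity bounds its `h` by `h n`. -/
theorem respects_insertCycle {h : ℕ → ℕ} (hh : Monotone h) :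
    Respects h (insertCycle (π, i, t)) ↔ Respects h π ∧ h n ≤ i := by
  constructor
  · intro H
    have hi : h n ≤ i := by simpa using H i
    refine ⟨fun a => ?_, hi⟩
    by_cases ha : a.castSucc = i
    · exact (hh (π.perm a).is_lt.le).trans (by rw [← ha] at hi; simpa using hi)
    · have := H a.castSucc
      rwa [insertCycle_perm_of_ne _ _ _ ha] at this
  · rintro ⟨H, hi⟩ a
    by_cases ha : a = i
    · subst ha
      simpa using hi
    · induction a using Fin.lastCases with
      | last =>
        obtain ⟨b, rfl⟩ := Fin.exists_castSucc_eq.2 (Ne.symm ha)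
        rw [insertCycle_perm_last]
        exact (H b).trans b.is_lt.le
      | cast a =>
        rw [insertCycle_perm_of_ne _ _ _ ha]
        exact H a

end

/-! ### The sorting index under insertion -/

section sor

theorem extend_mul_transposition (π : ColoredPerm r n) (i : Fin n) (t : ZMod r) (j : Fin n) :
    insertWord (π, Fin.last n, 0) * transposition i.castSucc t j.castSucc =
      insertWord (π * transposition i t j, Fin.last n, 0) := by
  refine ext_apply (fun a => ?_) fun a => ?_
  · induction a using Fin.lastCases with
    | last =>
      rw [insertWord_perm_self, mul_perm, transposition_perm, Equiv.Perm.mul_apply,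
        Equiv.swap_apply_of_ne_of_ne (Fin.castSucc_lt_last i).ne' (Fin.castSucc_lt_last j).ne',
        insertWord_perm_self]
    | cast a =>
      rw [extend_perm_castSucc, mul_perm, mul_perm, transposition_perm, transposition_perm,
        Equiv.Perm.mul_apply, Equiv.Perm.mul_apply, ← (Fin.castSucc_injective n).map_swap,
        extend_perm_castSucc]
  · induction a using Fin.lastCases with
    | last =>
      rw [insertWord_color_self, mul_color, transposition_perm,
        Equiv.swap_apply_of_ne_of_ne (Fin.castSucc_lt_last i).ne' (Fin.castSucc_lt_last j).ne',
        insertWord_color_self, transposition]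
      split_ifs <;> simp [(Fin.castSucc_lt_last i).ne', (Fin.castSucc_lt_last j).ne']
    | cast a =>
      rw [extend_color_castSucc, mul_color, mul_color, transposition_perm, transposition_perm,
        ← (Fin.castSucc_injective n).map_swap, extend_color_castSucc, transposition, transposition]
      congr 1
      simp only [Fin.castSucc_inj]
      split_ifs <;> simp [Pi.single_apply]

/-- Sorting the smaller letters never touches a largest letter that is already home and uncolored.
-/
theorem sortTotal_extend {k : ℕ} (hk : k ≤ n) (π : ColoredPerm r n) :
    sortTotal k (insertWord (π, Fin.last n, 0)) = sortTotal k π := by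
  induction k generalizing π with
  | zero => rfl
  | succ k ih =>
    have hj : (⟨k, by omega⟩ : Fin (n + 1)) = (⟨k, hk⟩ : Fin n).castSucc := rfl
    rw [sortTotal, sortTotal, dif_pos (by omega), dif_pos (by omega)]
    simp only [hj, insertWord_symm_castSucc, Fin.succAbove_last_apply, extend_color_castSucc,
      extend_mul_transposition]
    rw [ih (by omega)]
    rfl

theorem sor_insertCycle (π : ColoredPerm r n) (i : Fin (n + 1)) (t : ZMod r) :
    (insertCycle (π, i, t)).sor = insertCost n i t + π.sor := by
  rw [sor, sortTotal, dif_pos n.lt_succ_self]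
  have hj : (⟨n, n.lt_succ_self⟩ : Fin (n + 1)) = Fin.last n := rfl
  simp only [hj, insertCycle_symm_last, insertCycle_color_self, neg_neg]
  have hm : insertCycle (π, i, t) * transposition i t (Fin.last n) =
      insertWord (π, Fin.last n, 0) := by
    rw [insertCycle, inv_mul_cancel_right]
  rw [hm, sortTotal_extend le_rfl, sor]
  congr 1
  have := i.is_le
  simp only [sortDist, insertCost, label, Fin.val_last]
  split_ifs <;> omega

end sor

/-! ### Cycles under insertion -/

section Cyc

theorem sameCycle_map {α β : Type*} [Finite α] {σ : Equiv.Perm α} {τ : Equiv.Perm β}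
    {g : α → β} (hg : ∀ a, τ.SameCycle (g a) (g (σ a))) {a b : α} (h : σ.SameCycle a b) :
    τ.SameCycle (g a) (g b) := by
  obtain ⟨k, -, rfl⟩ := h.exists_pow_eq'
  induction k with
  | zero => exact Equiv.Perm.SameCycle.refl _ _
  | succ k ih =>
    rw [pow_succ', Equiv.Perm.mul_apply]
    exact (ih (Equiv.Perm.sameCycle_pow_right.2 (Equiv.Perm.SameCycle.refl _ _))).trans (hg _)

theorem sameCycle_apply (σ : Equiv.Perm (Fin n)) (a : Fin n) : σ.SameCycle a (σ a) :=
  Equiv.Perm.sameCycle_apply_right.2 (Equiv.Perm.SameCycle.refl _ _)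

variable (π : ColoredPerm r n) (i : Fin (n + 1)) (t : ZMod r)

theorem sameCycle_insertCycle_castSucc (a b : Fin n) :
    (insertCycle (π, i, t)).perm.SameCycle a.castSucc b.castSucc ↔ π.perm.SameCycle a b := by
  constructor
  · intro h
    -- The new letter is projected to `d`, its predecessor in the cycle. If it is a fixed point any
    -- value will do, and `a` is at hand.
    obtain ⟨d, hd⟩ : ∃ d : Fin n, ∀ c : Fin n, i = c.castSucc → d = c := by
      induction i using Fin.lastCases with
      | last => exact ⟨a, fun c hc => absurd hc (Fin.castSucc_lt_last c).ne'⟩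
      | cast i => exact ⟨i, fun c hc => Fin.castSucc_injective n hc⟩
    have := sameCycle_map (τ := π.perm)
      (g := fun c => Fin.lastCases (motive := fun _ => Fin n) d id c) (fun c => ?_) h
    · simpa using this
    · by_cases hc : c = i
      · subst hc
        rw [insertCycle_perm_self]
        induction c using Fin.lastCases with
        | last => exact Equiv.Perm.SameCycle.refl _ _
        | cast c =>
          simp only [Fin.lastCases_castSucc, Fin.lastCases_last, hd c rfl]
          exact Equiv.Perm.SameCycle.refl _ _
      · induction c using Fin.lastCases with
        | last =>
          obtain ⟨b, rfl⟩ := Fin.exists_castSucc_eq.2 (Ne.symm hc)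
          rw [insertCycle_perm_last, hd b rfl]
          simpa using sameCycle_apply _ _
        | cast c =>
          rw [insertCycle_perm_of_ne _ _ _ hc]
          simpa using sameCycle_apply _ _
  · refine sameCycle_map fun c => ?_
    by_cases hc : c.castSucc = i
    · subst hc
      have h₁ := sameCycle_apply (insertCycle (π, c.castSucc, t)).perm c.castSucc
      have h₂ := sameCycle_apply (insertCycle (π, c.castSucc, t)).perm (Fin.last n)
      rw [insertCycle_perm_self] at h₁
      rw [insertCycle_perm_last] at h₂
      exact h₁.trans h₂
    · rw [← insertCycle_perm_of_ne π i t hc]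
      exact sameCycle_apply _ _

theorem sameCycle_insertCycle_last (a b : Fin n) :
    (insertCycle (π, b.castSucc, t)).perm.SameCycle a.castSucc (Fin.last n) ↔
      π.perm.SameCycle a b := by
  rw [← sameCycle_insertCycle_castSucc π b.castSucc t]
  have h := sameCycle_apply (insertCycle (π, b.castSucc, t)).perm b.castSucc
  rw [insertCycle_perm_self] at h
  exact ⟨fun h' => h'.trans h.symm, fun h' => h'.trans h⟩

theorem sameCycle_insertCycle_last_last (a : Fin (n + 1)) :
    (insertCycle (π, Fin.last n, t)).perm.SameCycle (Fin.last n) a ↔ a = Fin.last n := by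
  constructor
  · intro h
    exact (h.eq_of_left (insertCycle_perm_self π (Fin.last n) t)).symm
  · rintro rfl
    exact Equiv.Perm.SameCycle.refl _ _

theorem isLeast_castSucc_iff (a : Fin n) :
    (∀ b, (insertCycle (π, i, t)).perm.SameCycle a.castSucc b → a.castSucc ≤ b) ↔
      ∀ b, π.perm.SameCycle a b → a ≤ b := by
  constructor
  · intro h b hb
    exact Fin.castSucc_le_castSucc_iff.1 (h _ ((sameCycle_insertCycle_castSucc π i t a b).2 hb))
  · intro h b
    induction b using Fin.lastCases with
    | last => exact fun _ => (Fin.castSucc_lt_last a).le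
    | cast b =>
      rw [sameCycle_insertCycle_castSucc, Fin.castSucc_le_castSucc_iff]
      exact h b

theorem isLeast_last_iff :
    (∀ b, (insertCycle (π, i, t)).perm.SameCycle (Fin.last n) b → Fin.last n ≤ b) ↔
      i = Fin.last n := by
  constructor
  · intro h
    refine le_antisymm (Fin.le_last i) (h i ?_)
    have := sameCycle_apply (insertCycle (π, i, t)).perm i
    rw [insertCycle_perm_self] at this
    exact this.symm
  · rintro rfl b hb
    rw [(sameCycle_insertCycle_last_last π t b).1 hb]

-- The splice replaces the step from `i` by two steps whose colors `-t` and `t + π.color i` add up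
-- to the old one.
open Classical in
theorem cycleColor_castSucc (a : Fin n) :
    ∑ b with (insertCycle (π, i, t)).perm.SameCycle a.castSucc b, (insertCycle (π, i, t)).color b =
      ∑ b with π.perm.SameCycle a b, π.color b := by
  rw [Finset.sum_filter, Finset.sum_filter, Fin.sum_univ_castSucc]
  simp only [sameCycle_insertCycle_castSucc]
  induction i using Fin.lastCases with
  | last =>
    rw [if_neg, add_zero]
    · refine Finset.sum_congr rfl fun b _ => ?_
      rw [insertCycle_color_of_ne _ _ _ (Fin.castSucc_lt_last b).ne]
    · intro h
      exact (Fin.castSucc_lt_last a).ne ((sameCycle_insertCycle_last_last π t _).1 h.symm)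
  | cast i =>
    simp only [sameCycle_insertCycle_last, insertCycle_color_last]
    rw [← Finset.add_sum_erase _ _ (Finset.mem_univ i),
      ← Finset.add_sum_erase _ (fun b => if π.perm.SameCycle a b then π.color b else 0)
        (Finset.mem_univ i), insertCycle_color_self]
    have : ∀ b ∈ Finset.univ.erase i, (if π.perm.SameCycle a b then
        (insertCycle (π, i.castSucc, t)).color b.castSucc else 0) =
        if π.perm.SameCycle a b then π.color b else 0 := by
      intro b hb
      rw [insertCycle_color_of_ne]
      exact (Fin.castSucc_injective n).ne (Finset.ne_of_mem_erase hb)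
    rw [Finset.sum_congr rfl this]
    split_ifs <;> ring

open Classical in
theorem prod_Cyc {M : Type*} [CommMonoid M] (F : Fin n × ZMod r → M) :
    ∏ a ∈ π.Cyc, F a = ∏ a, if ∀ b, π.perm.SameCycle a b → a ≤ b then
      F (a, ∑ i with π.perm.SameCycle a i, π.color i) else 1 := by
  rw [Cyc, Finset.prod_image fun a _ b _ h => congrArg Prod.fst h, Finset.prod_filter]

theorem prod_Cyc_insertCycle {M : Type*} [CommMonoid M] (F : ℕ → ZMod r → M) :
    ∏ a ∈ (insertCycle (π, i, t)).Cyc, F (label a.1) a.2 =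
      (∏ a ∈ π.Cyc, F (label a.1) a.2) * if (i : ℕ) = n then F (n + 1) (-t) else 1 := by
  classical
  rw [prod_Cyc _ fun a => F (label a.1) a.2, prod_Cyc _ fun a => F (label a.1) a.2,
    Fin.prod_univ_castSucc]
  congr 1
  · refine Finset.prod_congr rfl fun a _ => ?_
    simp only [isLeast_castSucc_iff, cycleColor_castSucc]
    rfl
  · simp only [isLeast_last_iff]
    by_cases hi : i = Fin.last n
    · subst hi
      simp only [if_true, Fin.val_last, sameCycle_insertCycle_last_last]
      simp [Finset.filter_eq', label]
    · rw [if_neg hi, if_neg]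
      simpa [Fin.ext_iff] using hi

end Cyc

/-! ### Minima along the orbit of the first letter -/

section Lmic

open Relation

/-- Paths are easier to lift and project than iterates, whose exponents shift under a splice. The
condition is put on the target of each step, so the starting point is exempt. -/
theorem exists_iterate_iff {α : Type*} {T : α → α} {P : α → Prop} {s a : α} :
    (∃ k, 1 ≤ k ∧ T^[k] s = a ∧ ∀ m, 1 ≤ m → m < k → P (T^[m] s)) ↔
      ∃ c, ReflTransGen (fun b c => T b = c ∧ P c) s c ∧ T c = a := by
  constructor
  · rintro ⟨k, hk, rfl, hP⟩
    obtain ⟨k, rfl⟩ := Nat.exists_eq_add_of_le' hk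
    refine ⟨T^[k] s, ?_, (Function.iterate_succ_apply' T k s).symm⟩
    have : ∀ j ≤ k, ReflTransGen (fun b c => T b = c ∧ P c) s (T^[j] s) := by
      intro j
      induction j with
      | zero => exact fun _ => ReflTransGen.refl
      | succ j ih =>
        intro hj
        exact (ih (by omega)).tail ⟨(Function.iterate_succ_apply' T j s).symm,
          hP _ (by omega) (by omega)⟩
    exact this k le_rfl
  · rintro ⟨c, hc, rfl⟩
    suffices ∃ k, T^[k] s = c ∧ ∀ m, 1 ≤ m → m ≤ k → P (T^[m] s) by
      obtain ⟨k, rfl, hP⟩ := this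
      exact ⟨k + 1, by omega, Function.iterate_succ_apply' T k s,
        fun m h₁ h₂ => hP m h₁ (by omega)⟩
    induction hc with
    | refl => exact ⟨0, rfl, fun m h₁ h₂ => by omega⟩
    | tail _ h ih =>
      obtain ⟨k, rfl, hP⟩ := ih
      obtain ⟨rfl, hc⟩ := h
      refine ⟨k + 1, Function.iterate_succ_apply' T k s, fun m h₁ h₂ => ?_⟩
      rcases h₂.eq_or_lt with rfl | h₂
      · rwa [Function.iterate_succ_apply']
      · exact hP m h₁ (by omega)

open Classical in
theorem mem_Lmic_iff [NeZero r] (π : ColoredPerm r n) (a : Fin n × ZMod r) (e : Fin n)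
    (he : (e : ℕ) = 0) : a ∈ π.Lmic ↔
      ∃ c, ReflTransGen (fun b c => π.act b = c ∧ a.1 < c.1) (e, 0) c ∧ π.act c = a := by
  rw [Lmic, Finset.mem_filter, ← exists_iterate_iff]
  constructor
  · rintro ⟨-, e', he', h⟩
    have : e' = e := by
      rw [label] at he'
      omega
    rwa [this] at h
  · exact fun h => ⟨Finset.mem_univ _, e, by rw [label, he], h⟩

variable (π : ColoredPerm r n) (i : Fin (n + 1)) (t : ZMod r)

theorem act_insertCycle_of_ne {a : Fin n} (h : a.castSucc ≠ i) (s : ZMod r) :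
    (insertCycle (π, i, t)).act (a.castSucc, s) =
      ((π.act (a, s)).1.castSucc, (π.act (a, s)).2) := by
  simp only [act, insertCycle_perm_of_ne _ _ _ h, insertCycle_color_of_ne _ _ _ h]

theorem act_insertCycle_self (s : ZMod r) :
    (insertCycle (π, i, t)).act (i, s) = (Fin.last n, -t + s) := by
  simp only [act, insertCycle_perm_self, insertCycle_color_self]

theorem act_insertCycle_last (b : Fin n) (u : ZMod r) :
    (insertCycle (π, b.castSucc, t)).act (Fin.last n, u) =
      ((π.act (b, t + u)).1.castSucc, (π.act (b, t + u)).2) := by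
  simp only [act, insertCycle_perm_last, insertCycle_color_last, Prod.mk.injEq, true_and]
  ring

/-- A step out of `i` becomes a detour through the new letter. That letter exceeds `m`, so the
detour is always admissible. -/
theorem lift_path {m : Fin n} {s c : Fin n × ZMod r}
    (h : ReflTransGen (fun b c => π.act b = c ∧ m < c.1) s c) :
    ReflTransGen (fun b c => (insertCycle (π, i, t)).act b = c ∧ m.castSucc < c.1)
      (s.1.castSucc, s.2) (c.1.castSucc, c.2) := by
  induction h with
  | refl => exact ReflTransGen.refl
  | @tail b c _ hbc ih =>
    obtain ⟨rfl, hm⟩ := hbc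
    by_cases hb : b.1.castSucc = i
    · subst hb
      refine (ih.tail ⟨act_insertCycle_self _ _ _ _, Fin.castSucc_lt_last m⟩).tail ⟨?_, hm⟩
      rw [act_insertCycle_last, add_neg_cancel_left]
    · exact ih.tail ⟨act_insertCycle_of_ne _ _ _ hb _, hm⟩

/-- A path halted at the new letter with color `u` has no image of its own; it stands for the point
`(b, t + u)` it came from, which has the same successor. -/
theorem project_path {m : Fin n} {s : Fin n × ZMod r} {c : Fin (n + 1) × ZMod r}
    (h : ReflTransGen (fun b c => (insertCycle (π, i, t)).act b = c ∧ m.castSucc < c.1)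
      (s.1.castSucc, s.2) c) :
    (∃ d, c = (d.1.castSucc, d.2) ∧ ReflTransGen (fun b c => π.act b = c ∧ m < c.1) s d) ∨
      ∃ b u, i = b.castSucc ∧ c = (Fin.last n, u) ∧
        ReflTransGen (fun b c => π.act b = c ∧ m < c.1) s (b, t + u) := by
  induction h with
  | refl => exact Or.inl ⟨s, rfl, ReflTransGen.refl⟩
  | tail _ hbc ih =>
    obtain ⟨rfl, hm⟩ := hbc
    rcases ih with ⟨d, rfl, hd⟩ | ⟨b, u, rfl, rfl, hb⟩
    · by_cases hdi : d.1.castSucc = i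
      · subst hdi
        exact Or.inr ⟨d.1, -t + d.2, rfl, act_insertCycle_self _ _ _ _,
          by rwa [add_neg_cancel_left]⟩
      · rw [act_insertCycle_of_ne _ _ _ hdi] at hm ⊢
        exact Or.inl ⟨_, rfl, hd.tail ⟨rfl, hm⟩⟩
    · rw [act_insertCycle_last] at hm ⊢
      exact Or.inl ⟨_, rfl, hb.tail ⟨rfl, hm⟩⟩

theorem castSucc_mem_Lmic_insertCycle [NeZero r] (a : Fin n) (s : ZMod r) :
    (a.castSucc, s) ∈ (insertCycle (π, i, t)).Lmic ↔ (a, s) ∈ π.Lmic := by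
  have hn : 0 < n := a.pos
  rw [mem_Lmic_iff π _ ⟨0, hn⟩ rfl, mem_Lmic_iff _ _ (⟨0, hn⟩ : Fin n).castSucc rfl]
  constructor
  · rintro ⟨c, hc, hca⟩
    rcases project_path π i t (s := (⟨0, hn⟩, 0)) hc with ⟨d, rfl, hd⟩ | ⟨b, u, rfl, rfl, hb⟩
    · refine ⟨d, hd, ?_⟩
      by_cases hdi : d.1.castSucc = i
      · subst hdi
        rw [act_insertCycle_self] at hca
        exact absurd (congrArg Prod.fst hca).symm (Fin.castSucc_lt_last a).ne
      · rw [act_insertCycle_of_ne _ _ _ hdi] at hca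
        simp only [Prod.mk.injEq, Fin.castSucc_inj] at hca
        exact Prod.ext hca.1 hca.2
    · refine ⟨_, hb, ?_⟩
      rw [act_insertCycle_last] at hca
      simp only [Prod.mk.injEq, Fin.castSucc_inj] at hca
      exact Prod.ext hca.1 hca.2
  · rintro ⟨c, hc, hca⟩
    have hl := lift_path π i t hc
    by_cases hci : c.1.castSucc = i
    · subst hci
      refine ⟨_, hl.tail ⟨act_insertCycle_self _ _ _ _, Fin.castSucc_lt_last a⟩, ?_⟩
      rw [act_insertCycle_last, add_neg_cancel_left, hca]
    · refine ⟨_, hl, ?_⟩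
      rw [act_insertCycle_of_ne _ _ _ hci, hca]

/-- No earlier entry can exceed the largest letter, so it must be the very first entry of the orbit
word. -/
theorem last_mem_Lmic_insertCycle [NeZero r] (s : ZMod r) :
    (Fin.last n, s) ∈ (insertCycle (π, i, t)).Lmic ↔ (i : ℕ) = 0 ∧ s = -t := by
  rw [mem_Lmic_iff _ _ 0 rfl]
  have h0 : (i : ℕ) = 0 ↔ 0 = i := by
    rw [Fin.ext_iff, eq_comm]
    rfl
  rw [h0]
  constructor
  · rintro ⟨c, hc, h⟩
    rcases hc.cases_tail with rfl | ⟨b, -, -, hlt⟩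
    · have h₁ : (insertCycle (π, i, t)).perm 0 = Fin.last n := congrArg Prod.fst h
      rw [← Equiv.eq_symm_apply, insertCycle_symm_last] at h₁
      subst h₁
      rw [act_insertCycle_self] at h
      exact ⟨rfl, by simpa using (congrArg Prod.snd h).symm⟩
    · exact absurd hlt (Fin.le_last _).not_gt
  · rintro ⟨rfl, rfl⟩
    refine ⟨_, ReflTransGen.refl, ?_⟩
    rw [act_insertCycle_self, add_zero]

theorem prod_Lmic_insertCycle [NeZero r] {M : Type*} [CommMonoid M] (F : ℕ → ZMod r → M) :
    ∏ a ∈ (insertCycle (π, i, t)).Lmic, F (label a.1) a.2 =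
      (∏ a ∈ π.Lmic, F (label a.1) a.2) * if (i : ℕ) = 0 then F (n + 1) (-t) else 1 := by
  rw [← Fintype.prod_ite_mem, ← Fintype.prod_ite_mem π.Lmic, Fintype.prod_prod_type,
    Fintype.prod_prod_type, Fin.prod_univ_castSucc]
  congr 1
  · simp only [castSucc_mem_Lmic_insertCycle]
    rfl
  · simp only [last_mem_Lmic_insertCycle]
    by_cases hi : (i : ℕ) = 0 <;> simp [hi, label]

end Lmic

open Classical in
theorem sum_sor_eq [NeZero r] {R : Type*} [CommRing R] (q : R) (x y : ℕ → ℕ → R)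
    {h : ℕ → ℕ} (hh : Monotone h) (n : ℕ) :
    ∑ π : ColoredPerm r n with Respects h π,
      q ^ π.sor * ∏ t ∈ Finset.range r, ((∏ i ∈ refined π.Cyc (t : ZMod r), x t i) *
        ∏ i ∈ refined π.Lmic (t : ZMod r), y t i) =
      ∏ j ∈ Finset.range n, ∑ i ∈ Finset.Icc (h j) j, ∑ t : ZMod r, insertWeight q x y j i t := by
  have hw : ∀ {n : ℕ} (π : ColoredPerm r n), ∏ t ∈ Finset.range r,
      ((∏ i ∈ refined π.Cyc (t : ZMod r), x t i) * ∏ i ∈ refined π.Lmic (t : ZMod r), y t i) =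
      (∏ a ∈ π.Cyc, x a.2.val (label a.1)) * ∏ a ∈ π.Lmic, y a.2.val (label a.1) := by
    intro n π
    rw [Finset.prod_mul_distrib]
    exact congrArg₂ _ (prod_range_refined π.Cyc (Equiv.refl _) x)
      (prod_range_refined π.Lmic (Equiv.refl _) y)
  simp only [hw]
  refine sum_respects_eq_prod (W := fun n π => q ^ π.sor *
      ((∏ a ∈ π.Cyc, x a.2.val (label a.1)) * ∏ a ∈ π.Lmic, y a.2.val (label a.1)))
    (w := insertWeight q x y) (fun _ => insertCycle_injective)
    (fun n π i t => respects_insertCycle π i t hh) (fun π => ?_) (fun n π i t => ?_) n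
  · have h₁ : π.Cyc = ∅ := Finset.eq_empty_of_forall_notMem fun a => a.1.elim0
    have h₂ : π.Lmic = ∅ := Finset.eq_empty_of_forall_notMem fun a => a.1.elim0
    simp [h₁, h₂, sor, sortTotal]
  · rw [prod_Cyc_insertCycle π i t fun k s => x s.val k,
      prod_Lmic_insertCycle π i t fun k s => y s.val k, sor_insertCycle, insertWeight, pow_add]
    ring

/-! ### The shape and the smallest positions -/

/-- The number of positions at which the letter `j` (counted from zero) is not allowed. -/
def forbidden (f : Fin n → ℕ) (j : ℕ) : ℕ := (Finset.univ.filter fun i => f i ≤ j).card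

theorem forbidden_mono (f : Fin n → ℕ) : Monotone (forbidden f) := fun _ _ hab =>
  Finset.card_le_card (Finset.monotone_filter_right _ fun _ _ hi => le_trans hi hab)

/-- As `f` is monotone, the positions closed to a letter form an initial segment, so their number is
the first open position, counted from zero. -/
theorem forbidden_le_iff {f : Fin n → ℕ} (hf : Monotone f) (i : Fin n) (j : ℕ) :
    forbidden f j ≤ i ↔ j + 1 ≤ f i := by
  constructor
  · intro h
    by_contra hcon
    have : (Finset.Iic i).card ≤ forbidden f j := Finset.card_le_card fun a ha => by
      have := hf (Finset.mem_Iic.1 ha)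
      simp only [Finset.mem_filter, Finset.mem_univ, true_and]
      omega
    rw [Fin.card_Iic] at this
    omega
  · intro h
    rw [← Fin.card_Iio i]
    refine Finset.card_le_card fun a ha => ?_
    rw [Finset.mem_Iio]
    by_contra hcon
    have := hf (not_lt.1 hcon)
    have := (Finset.mem_filter.1 ha).2
    omega

theorem mem_restricted_iff [NeZero r] {f : Fin n → ℕ} (hf : Monotone f) (π : ColoredPerm r n) :
    π ∈ restricted r f ↔ Respects (forbidden f) π := by
  simp [restricted, Respects, forbidden_le_iff hf, label]

/-- By pigeonhole: the first `j + 1` positions carry distinct letters that all lie below the bound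
at position `j`. -/
theorem forbidden_le_self [NeZero r] {f : Fin n → ℕ} (hf : Monotone f)
    (hne : (restricted r f).Nonempty) {j : ℕ} (hj : j < n) : forbidden f j ≤ j := by
  obtain ⟨π, hπ⟩ := hne
  have hπ : ∀ i, label (π.perm i) ≤ f i := (Finset.mem_filter.1 hπ).2
  rw [forbidden_le_iff hf ⟨j, hj⟩ j]
  have : (Finset.Iic (⟨j, hj⟩ : Fin n)).card ≤ (Finset.range (f ⟨j, hj⟩)).card := by
    refine Finset.card_le_card_of_injOn (fun i => (π.perm i : ℕ)) (fun i hi => ?_) fun a _ b _ h =>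
      π.perm.injective (Fin.ext h)
    rw [Finset.mem_coe, Finset.mem_range]
    exact (hπ i).trans (hf (Finset.mem_Iic.1 hi))
  rwa [Fin.card_Iic, Finset.card_range] at this

theorem minPos_eq [NeZero r] {f : Fin n → ℕ} (hf : Monotone f)
    (hne : (restricted r f).Nonempty) {j : ℕ} (hj : j < n) :
    minPos r f (j + 1) = forbidden f j + 1 := by
  have hle := forbidden_le_self hf hne hj
  have hmem : forbidden f j + 1 ∈ {p | ∃ π ∈ restricted r f, ∃ i : Fin n, label i = p ∧
      label (π.perm i) = j + 1} := by
    -- The identity fits the shape; swapping `j` into its first open position sends a smaller letter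
    -- to the right, which is harmless.
    refine ⟨swapGen r ⟨forbidden f j, by omega⟩ ⟨j, hj⟩, ?_, ⟨forbidden f j, by omega⟩, rfl, ?_⟩
    · rw [mem_restricted_iff hf]
      intro i
      simp only [swapGen, Equiv.swap_apply_def]
      split_ifs with h₁ h₂
      · rw [h₁]
      · rw [h₂]
        exact (forbidden_mono f hle).trans hle
      · exact forbidden_le_self hf hne i.is_lt
    · simp [swapGen, label]
  refine le_antisymm (Nat.sInf_le hmem) (le_csInf ⟨_, hmem⟩ ?_)
  rintro p ⟨π, hπ, i, rfl, hi⟩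
  have := (mem_restricted_iff hf π).1 hπ i
  simp only [label] at hi ⊢
  have hi' : (π.perm i : ℕ) = j := by omega
  rw [hi'] at this
  omega

/-! ### Expansion of the factors -/

theorem sum_zmod_eq [NeZero r] {M : Type*} [AddCommMonoid M] (G : ZMod r → M) :
    ∑ t, G t = G 0 + ∑ t ∈ Finset.Icc 1 (r - 1), G (t : ZMod r) := by
  have h : ∑ t, G t = ∑ t ∈ Finset.range r, G (t : ZMod r) := by
    refine Finset.sum_bij' (fun t _ => t.val) (fun t _ => (t : ZMod r))
      (fun t _ => Finset.mem_range.2 t.val_lt) (fun _ _ => Finset.mem_univ _)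
      (fun t _ => ZMod.natCast_zmod_val t) (fun t ht => ZMod.val_cast_of_lt (Finset.mem_range.1 ht))
      fun t _ => by rw [ZMod.natCast_zmod_val]
  have hr := NeZero.pos r
  have hs : Finset.range r = insert 0 (Finset.Icc 1 (r - 1)) := by
    ext t
    simp only [Finset.mem_range, Finset.mem_insert, Finset.mem_Icc]
    omega
  rw [h, hs, Finset.sum_insert (by simp), Nat.cast_zero]

theorem insertWeight_zero {R : Type*} [CommRing R] (q : R) (x y : ℕ → ℕ → R) (j i : ℕ) :
    insertWeight q x y j i (0 : ZMod r) = xi (i + 1 = j + 1) (x 0 (j + 1)) *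
      xi (i + 1 = 1) (y 0 (j + 1)) * q ^ (j + 1 - (i + 1)) := by
  simp [insertWeight, xi, insertCost]

theorem insertWeight_natCast [NeZero r] {R : Type*} [CommRing R] (q : R) (x y : ℕ → ℕ → R)
    (j i : ℕ) {t : ℕ} (ht : t ∈ Finset.Icc 1 (r - 1)) :
    insertWeight q x y j i (t : ZMod r) = xi (i + 1 = j + 1) (x (r - t) (j + 1)) *
      xi (i + 1 = 1) (y (r - t) (j + 1)) * q ^ (j + 1 + (i + 1) + t - 2) := by
  rw [Finset.mem_Icc] at ht
  have hv : (t : ZMod r).val = t := ZMod.val_cast_of_lt (by omega)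
  have h0 : (t : ZMod r) ≠ 0 := by
    rw [Ne, ← ZMod.val_eq_zero, hv]
    omega
  have hq : j + 1 + (i + 1) + t - 2 = j + i + t := by omega
  simp [insertWeight, xi, insertCost, ZMod.neg_val, h0, hv, hq]

theorem sum_insertWeight_eq [NeZero r] {R : Type*} [CommRing R] (q : R) (x y : ℕ → ℕ → R)
    (h j : ℕ) : ∑ i ∈ Finset.Icc h j, ∑ t : ZMod r, insertWeight q x y j i t =
      (∑ i ∈ Finset.Icc (h + 1) (j + 1), xi (i = j + 1) (x 0 (j + 1)) * xi (i = 1) (y 0 (j + 1)) *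
        q ^ (j + 1 - i)) +
      ∑ t ∈ Finset.Icc 1 (r - 1), ∑ i ∈ Finset.Icc (h + 1) (j + 1),
        xi (i = j + 1) (x (r - t) (j + 1)) * xi (i = 1) (y (r - t) (j + 1)) *
          q ^ (j + 1 + i + t - 2) := by
  have hshift : ∀ F : ℕ → R, ∑ i ∈ Finset.Icc (h + 1) (j + 1), F i =
      ∑ i ∈ Finset.Icc h j, F (i + 1) := by
    intro F
    rw [← Finset.map_add_right_Icc, Finset.sum_map]
    rfl
  simp only [hshift, sum_zmod_eq, Finset.sum_add_distrib, insertWeight_zero]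
  rw [Finset.sum_comm]
  congr 1
  exact Finset.sum_congr rfl fun t ht => Finset.sum_congr rfl fun i _ =>
    insertWeight_natCast q x y j i ht

end ColoredPerm

open ColoredPerm in
theorem theorem5p2 (r n : ℕ) [NeZero r] [NeZero n] (f : Fin n → ℕ) (hf : Monotone f)
    (hf1 : ∀ i, 1 ≤ f i ∧ f i ≤ n) (hne : (restricted r f).Nonempty)
    {R : Type*} [CommRing R] (q : R) (x y : ℕ → ℕ → R) :
    (∑ π ∈ restricted r f, q ^ π.length * ∏ t ∈ Finset.range r,
        ((∏ i ∈ refined π.Rmil (-(t : ZMod r)), x t i) *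
          ∏ i ∈ refined π.Lmil (-(t : ZMod r)), y t i)
      = ∑ π ∈ restricted r f, q ^ π.sor * ∏ t ∈ Finset.range r,
        ((∏ i ∈ refined π.Cyc (t : ZMod r), x t i) *
          ∏ i ∈ refined π.Lmic (t : ZMod r), y t i)) ∧
    (∑ π ∈ restricted r f, q ^ π.sor * ∏ t ∈ Finset.range r,
        ((∏ i ∈ refined π.Cyc (t : ZMod r), x t i) *
          ∏ i ∈ refined π.Lmic (t : ZMod r), y t i)
      = ∏ j ∈ Finset.Icc 1 n,
        ((∑ i ∈ Finset.Icc (minPos r f j) j,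
            xi (i = j) (x 0 j) * xi (i = 1) (y 0 j) * q ^ (j - i)) +
          ∑ t ∈ Finset.Icc 1 (r - 1), ∑ i ∈ Finset.Icc (minPos r f j) j,
            xi (i = j) (x (r - t) j) * xi (i = 1) (y (r - t) j) * q ^ (j + i + t - 2))) := by

  classical
  have hres : restricted r f = Finset.univ.filter fun π => Respects (forbidden f) π := by
    ext π
    simp [mem_restricted_iff hf]
  have hprod : ∏ j ∈ Finset.Icc 1 n,
      ((∑ i ∈ Finset.Icc (minPos r f j) j,
          xi (i = j) (x 0 j) * xi (i = 1) (y 0 j) * q ^ (j - i)) +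
        ∑ t ∈ Finset.Icc 1 (r - 1), ∑ i ∈ Finset.Icc (minPos r f j) j,
          xi (i = j) (x (r - t) j) * xi (i = 1) (y (r - t) j) * q ^ (j + i + t - 2)) =
      ∏ j ∈ Finset.range n, ∑ i ∈ Finset.Icc (forbidden f j) j,
        ∑ t : ZMod r, insertWeight q x y j i t := by
    rw [Finset.range_eq_Ico, ← Finset.Ico_add_one_right_eq_Icc, ← Finset.prod_Ico_add' _ 0 n 1]
    refine Finset.prod_congr rfl fun j hj => ?_
    rw [minPos_eq hf hne (Finset.mem_Ico.1 hj).2, sum_insertWeight_eq]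
  rw [hprod, hres]
  have hl := sum_length_eq (r := r) q x y (forbidden_mono f) n
  have hs := sum_sor_eq (r := r) q x y (forbidden_mono f) n
  refine ⟨?_, ?_⟩
  · convert hl.trans hs.symm
  · convert hs
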